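/- Proposition 3.3. Let $L$ be a countably infinite set, let $\Gamma$ be the free group on $L$, and let $T:\Gamma\to\Gamma$ be the group automorphism induced by an arbitrary bijection $L\to L$ (which may have nontrivial finite orbits). Let $\lambda$ be the left regular representation of $\Gamma$ on $\ell^2(\Gamma)$, $[\lambda(g)f](h)=f(g^{-1}h)$, let $A=C^*_r(\Gamma)\subseteq B(\ell^2(\Gamma))$ be the C*-algebra generated by $\{\lambda(g):g\in\Gamma\}$, and let $\alpha$ be the $*$-automorphism of $A$ determined by $\alpha(\lambda(g))=\lambda(Tg)$ for all $g\in\Gamma$. Then the dual system of $(\Gamma,T)$, i.e. $A$ with the action $n\mapsto\alpha^n$ of $\mathbb{Z}$, is uniquely ergodic relative to its fixed point algebra $A^\alpha=\{a\in A:\alpha(a)=a\}$: every state on $A^\alpha$ has a unique extension to a state $\psi$ on $A$ with $\psi\circ\alpha=\psi$. -/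

import Mathlib

open scoped ComplexOrder

noncomputable section

namespace DualSystem

section States

/-- A state on a unital C*-algebra: a positive linear functional `φ` with `φ 1 = 1`
(the positive elements of a C*-algebra are exactly those of the form `a⋆ a`). -/
structure IsState {A : Type*} [CStarAlgebra A] (φ : A →ₗ[ℂ] ℂ) : Prop where
  map_one : φ 1 = 1
  nonneg : ∀ a : A, 0 ≤ φ (star a * a)

variable {G A : Type*} [Monoid G] [CStarAlgebra A]

/-- The fixed point algebra `A^α = {a ∈ A | α_g a = a for all g ∈ G}` of a C*-dynamical system
given by an action `α` of `G` on `A` by *-automorphisms. -/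
def fixedPointAlgebra (α : G →* (A ≃⋆ₐ[ℂ] A)) : StarSubalgebra ℂ A where
  carrier := {a | ∀ g, α g a = a}
  mul_mem' ha hb g := by rw [map_mul, ha g, hb g]
  add_mem' ha hb g := by rw [map_add, ha g, hb g]
  algebraMap_mem' r g := by rw [Algebra.algebraMap_eq_smul_one, map_smul, map_one]
  star_mem' ha g := by rw [map_star, ha g]

instance fixedPointAlgebra_isClosed (α : G →* (A ≃⋆ₐ[ℂ] A)) :
    IsClosed (fixedPointAlgebra α : Set A) := by
  have h : (fixedPointAlgebra α : Set A) = ⋂ g, {a | α g a = a} := by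
    ext a
    simp [fixedPointAlgebra]
  rw [h]
  exact isClosed_iInter fun g =>
    isClosed_eq (StarAlgEquiv.isometry (α g)).continuous continuous_id

/-- `φ` is invariant: `φ ∘ α_g = φ` for all `g`. -/
def IsInvariant (α : G →* (A ≃⋆ₐ[ℂ] A)) (φ : A →ₗ[ℂ] ℂ) : Prop :=
  ∀ g a, φ (α g a) = φ a

/-- The system `(A, α)` is uniquely ergodic relative to its fixed point algebra `A^α`: every state
on the C*-algebra `A^α` has a unique extension to an invariant state of `(A, α)`. -/
def UniquelyErgodicRelFixed (α : G →* (A ≃⋆ₐ[ℂ] A)) : Prop :=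
  ∀ φ : fixedPointAlgebra α →ₗ[ℂ] ℂ, IsState φ →
    ∃! ψ : A →ₗ[ℂ] ℂ, IsState ψ ∧ IsInvariant α ψ ∧ ∀ a : fixedPointAlgebra α, ψ a = φ a

end States

section Reduced

/-- The Hilbert space `ℓ²(X)` of square summable complex functions on `X`. -/
abbrev L2 (X : Type*) : Type _ := lp (fun _ : X => ℂ) 2

variable {X : Type*}

/-- The unitary on `ℓ²(X)` induced by a permutation `σ` of `X`: `f ↦ f ∘ σ⁻¹`. -/
def permIsometry (σ : Equiv.Perm X) : L2 X ≃ₗᵢ[ℂ] L2 X where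
  toFun f := ⟨fun x => f (σ⁻¹ x), by
    have h := (lp.memℓp f).summable (by norm_num)
    exact memℓp_gen ((Equiv.summable_iff (σ⁻¹)).2 h)⟩
  invFun f := ⟨fun x => f (σ x), by
    have h := (lp.memℓp f).summable (by norm_num)
    exact memℓp_gen ((Equiv.summable_iff σ).2 h)⟩
  map_add' f g := rfl
  map_smul' c f := rfl
  left_inv f := by
    ext x
    exact congrArg f (σ.symm_apply_apply x)
  right_inv f := by
    ext x
    exact congrArg f (σ.apply_symm_apply x)
  norm_map' f := by
    rw [lp.norm_eq_tsum_rpow (by norm_num), lp.norm_eq_tsum_rpow (by norm_num)]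
    congr 1
    exact Equiv.tsum_eq (σ⁻¹) fun x => ‖f x‖ ^ (2 : ENNReal).toReal

/-- Permutations of `X` act unitarily on `ℓ²(X)`. -/
def permUnitary : Equiv.Perm X →* unitary (L2 X →L[ℂ] L2 X) :=
  (Unitary.linearIsometryEquiv (𝕜 := ℂ) (H := L2 X)).symm.toMonoidHom.comp
    { toFun := permIsometry
      map_one' := rfl
      map_mul' := fun _ _ => rfl }

theorem permUnitary_apply (σ : Equiv.Perm X) (f : L2 X) (x : X) :
    (permUnitary σ : L2 X →L[ℂ] L2 X) f x = f (σ⁻¹ x) := rfl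

variable (Γ : Type*) [Group Γ]

/-- The left regular representation `λ` of `Γ` on `ℓ²(Γ)`: `(λ(g) f)(h) = f (g⁻¹ h)`. -/
def leftRegular : Γ →* unitary (L2 Γ →L[ℂ] L2 Γ) :=
  permUnitary.comp (MulAction.toPermHom Γ Γ)

theorem leftRegular_apply (g h : Γ) (f : L2 Γ) :
    (leftRegular Γ g : L2 Γ →L[ℂ] L2 Γ) f h = f (g⁻¹ * h) := rfl

/-- The reduced group C*-algebra `C*_r(Γ)`: the C*-subalgebra of `B(ℓ²(Γ))` generated by the
operators `λ(g)`, `g ∈ Γ`. -/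
def reducedCStar : StarSubalgebra ℂ (L2 Γ →L[ℂ] L2 Γ) :=
  (StarAlgebra.adjoin ℂ
    (Set.range fun g : Γ => (leftRegular Γ g : L2 Γ →L[ℂ] L2 Γ))).topologicalClosure

instance reducedCStar_isClosed : IsClosed (reducedCStar Γ : Set (L2 Γ →L[ℂ] L2 Γ)) :=
  StarSubalgebra.isClosed_topologicalClosure _

variable {Γ}

theorem leftRegular_mem (g : Γ) :
    (leftRegular Γ g : L2 Γ →L[ℂ] L2 Γ) ∈ reducedCStar Γ :=
  StarSubalgebra.le_topologicalClosure _ (StarAlgebra.subset_adjoin ℂ _ ⟨g, rfl⟩)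

/-- Conjugation `a ↦ U_T a U_T⋆` on `B(ℓ²(Γ))`, where `U_T f = f ∘ T⁻¹`. -/
def conjAut (T : MulAut Γ) : (L2 Γ →L[ℂ] L2 Γ) ≃⋆ₐ[ℂ] (L2 Γ →L[ℂ] L2 Γ) :=
  Unitary.conjStarAlgAut ℂ _ (permUnitary (MulAut.toPerm Γ T))

theorem conjAut_leftRegular (T : MulAut Γ) (g : Γ) :
    conjAut T (leftRegular Γ g) = (leftRegular Γ (T g) : L2 Γ →L[ℂ] L2 Γ) := by
  have h : MulAut.toPerm Γ T * MulAction.toPermHom Γ Γ g * (MulAut.toPerm Γ T)⁻¹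
      = MulAction.toPermHom Γ Γ (T g) := by
    ext x
    change T (g * T.symm x) = T g * x
    simp
  have h2 := congrArg (fun u => ((permUnitary u : unitary _) : L2 Γ →L[ℂ] L2 Γ)) h
  rw [map_mul, map_mul, map_inv] at h2
  exact h2

theorem conjAut_mem (T : MulAut Γ) {a : L2 Γ →L[ℂ] L2 Γ} (ha : a ∈ reducedCStar Γ) :
    conjAut T a ∈ reducedCStar Γ := by
  have hle : reducedCStar Γ ≤
      (reducedCStar Γ).comap ((conjAut T : _ ≃⋆ₐ[ℂ] _) : _ →⋆ₐ[ℂ] (L2 Γ →L[ℂ] L2 Γ)) := by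
    refine StarSubalgebra.topologicalClosure_minimal ?_ ?_
    · refine StarAlgebra.adjoin_le ?_
      rintro _ ⟨g, rfl⟩
      change conjAut T (leftRegular Γ g) ∈ reducedCStar Γ
      rw [conjAut_leftRegular]
      exact leftRegular_mem _
    · exact (reducedCStar_isClosed Γ).preimage (StarAlgEquiv.isometry (conjAut T)).continuous
  exact hle ha

theorem conjAut_inv (T : MulAut Γ) : conjAut T⁻¹ = (conjAut T)⁻¹ := by
  simp only [conjAut, map_inv]

/-- The *-automorphism `α` of `C*_r(Γ)` with `α (λ(g)) = λ(T g)`: the restriction of `conjAut T`. -/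
def dualAut (T : MulAut Γ) : reducedCStar Γ ≃⋆ₐ[ℂ] reducedCStar Γ where
  toFun a := ⟨conjAut T a, conjAut_mem T a.2⟩
  invFun a := ⟨conjAut T⁻¹ a, conjAut_mem T⁻¹ a.2⟩
  left_inv a := Subtype.ext (by
    change conjAut T⁻¹ (conjAut T (a : L2 Γ →L[ℂ] L2 Γ)) = a
    rw [conjAut_inv]
    exact (conjAut T).symm_apply_apply (a : L2 Γ →L[ℂ] L2 Γ))
  right_inv a := Subtype.ext (by
    change conjAut T (conjAut T⁻¹ (a : L2 Γ →L[ℂ] L2 Γ)) = a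
    rw [conjAut_inv]
    exact (conjAut T).apply_symm_apply (a : L2 Γ →L[ℂ] L2 Γ))
  map_mul' a b := Subtype.ext (map_mul (conjAut T) _ _)
  map_add' a b := Subtype.ext (map_add (conjAut T) _ _)
  map_star' a := Subtype.ext (map_star (conjAut T) _)
  map_smul' c a := Subtype.ext (map_smul (conjAut T) c _)

theorem dualAut_leftRegular (T : MulAut Γ) (g : Γ) :
    dualAut T ⟨leftRegular Γ g, leftRegular_mem g⟩ = ⟨leftRegular Γ (T g), leftRegular_mem _⟩ :=
  Subtype.ext (conjAut_leftRegular T g)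

/-- The dual system of `(Γ, T)`: the action `n ↦ αⁿ` of `ℤ` on `C*_r(Γ)`, where `α` is the
*-automorphism with `α (λ(g)) = λ(T g)`. -/
def dualSystem (T : MulAut Γ) : Multiplicative ℤ →* (reducedCStar Γ ≃⋆ₐ[ℂ] reducedCStar Γ) :=
  zpowersHom _ (dualAut T)

end Reduced

end DualSystem

end

open scoped ComplexOrder

noncomputable section

open Filter Topology Function

namespace DualSystem

/-! ### Norm convergence of Cesàro averages -/

section MeanErgodic

/-! If the Cesàro averages of `α` converge in norm at every element, their limit `E` is a positive
projection onto the fixed point algebra. Then `φ ∘ E` is an invariant extension of a state `φ`, and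
every invariant state `ψ` satisfies `ψ = ψ ∘ E` by continuity, which gives uniqueness
(`uniquelyErgodicRelFixed_of_cauchySeq`).

The averages are contractions, so convergence need only be checked on the unitaries `λ(g)`, whose
span is dense. If `g` is periodic under `T`, so is `λ(g)`, and its averages converge to the mean
over one period. Otherwise the words `Tᵏ g` are distinct, and all have the length `l` of `g`, since
`T` permutes the letters. Haagerup's inequality (`norm_sum_leftRegular_le`) then bounds the norm of
the sum of the first `n` unitaries `λ(Tᵏ g)` by `(l + 1)√n`, so the averages tend to `0`. -/

/-- The points with Cauchy Birkhoff averages under a contraction form a closed set. -/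
theorem isClosed_setOf_cauchySeq_birkhoffAverage {E : Type*} [NormedAddCommGroup E]
    [NormedSpace ℂ E] {f : E → E} (hf : LipschitzWith 1 f) :
    IsClosed {x | CauchySeq (birkhoffAverage ℂ f _root_.id · x)} := by
  refine isClosed_of_closure_subset fun x hx => ?_
  rw [Set.mem_ofPred_eq, Metric.cauchySeq_iff]
  intro ε hε
  obtain ⟨δ, hδ, h⟩ := Metric.uniformEquicontinuous_iff.1
    (uniformEquicontinuous_birkhoffAverage ℂ hf uniformContinuous_id) (ε / 3) (by positivity)
  obtain ⟨y, hy, hxy⟩ := Metric.mem_closure_iff.1 hx δ hδ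
  obtain ⟨N, hN⟩ := Metric.cauchySeq_iff.1 hy (ε / 3) (by positivity)
  refine ⟨N, fun m hm n hn => ?_⟩
  have h1 := h x y hxy m
  have h2 := h x y hxy n
  have h3 := hN m hm n hn
  rw [dist_comm] at h2
  have := dist_triangle4 (birkhoffAverage ℂ f _root_.id m x) (birkhoffAverage ℂ f _root_.id m y)
    (birkhoffAverage ℂ f _root_.id n y) (birkhoffAverage ℂ f _root_.id n x)
  linarith

/-- The Birkhoff averages of a periodic point converge. -/
theorem cauchySeq_birkhoffAverage_of_isPeriodicPt {E : Type*} [NormedAddCommGroup E]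
    [NormedSpace ℂ E] (f : E →ₗ[ℂ] E) (hf : LipschitzWith 1 f) {x : E} {p : ℕ} (hp : 0 < p)
    (hx : IsPeriodicPt f p x) :
    CauchySeq (birkhoffAverage ℂ f _root_.id · x) := by
  -- The sum over one period is fixed, so its averages converge; the averages at the points `f^[k]
  -- x` are asymptotically equal, so they share this limit up to the factor `p`.
  have hfx : f (birkhoffSum f _root_.id p x) = birkhoffSum f _root_.id p x := by
    have h1 : f (birkhoffSum f _root_.id p x) = birkhoffSum f _root_.id p (f x) := by
      simp [birkhoffSum, map_sum, ← iterate_succ_apply' f, iterate_succ_apply]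
    rw [h1, ← sub_eq_zero, birkhoffSum_apply_sub_birkhoffSum, hx.eq, sub_self]
  have hbdd : Bornology.IsBounded (Set.range (_root_.id <| f^[·] x)) :=
    isBounded_iff_forall_norm_le.2 ⟨‖x‖, Set.forall_mem_range.2 fun n ↦ by
      have H : f^[n] 0 = 0 := iterate_map_zero f n
      simpa [H] using (hf.iterate n).dist_le_mul x 0⟩
  have hk : ∀ k : ℕ, Tendsto (fun n => birkhoffAverage ℂ f _root_.id n (f^[k] x)
      - birkhoffAverage ℂ f _root_.id n x) atTop (𝓝 0) := fun k => by
    induction k with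
    | zero => simp
    | succ k ih =>
      have h1 := tendsto_birkhoffAverage_apply_sub_birkhoffAverage ℂ (f := f) (g := _root_.id)
        (x := f^[k] x) (hbdd.subset (Set.range_subset_iff.2 fun n =>
          ⟨n + k, by simp only [iterate_add_apply]⟩))
      have h2 := h1.add ih
      rw [add_zero] at h2
      refine h2.congr fun n => ?_
      rw [iterate_succ_apply']
      abel
  have hsum := (tendsto_finsetSum (Finset.range p) fun k _ => hk k)
  have hb := IsFixedPt.tendsto_birkhoffAverage ℂ hfx _root_.id
  refine (((hb.sub hsum).const_smul ((p : ℂ)⁻¹)).congr fun n => ?_).cauchySeq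
  have hp' : (p : ℂ) ≠ 0 := Nat.cast_ne_zero.2 hp.ne'
  have havg : birkhoffAverage ℂ f _root_.id n (birkhoffSum f _root_.id p x)
      = ∑ k ∈ Finset.range p, birkhoffAverage ℂ f _root_.id n (f^[k] x) := by
    simp only [birkhoffAverage, birkhoffSum, _root_.id, ← Finset.smul_sum]
    rw [Finset.sum_comm]
    simp only [← Module.End.pow_apply, map_sum]
  rw [havg, ← Finset.sum_sub_distrib]
  simp [hp', ← Nat.cast_smul_eq_nsmul ℂ]

end MeanErgodic

/-! ### From norm convergence to unique ergodicity -/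

section UniqueErgodicity

variable {A : Type*} [CStarAlgebra A]

theorem IsState.continuous {φ : A →ₗ[ℂ] ℂ} (hφ : IsState φ) : Continuous φ := by
  let _ := CStarAlgebra.spectralOrder A
  have := CStarAlgebra.spectralOrderedRing A
  let ψ : A →ₚ[ℂ] ℂ := PositiveLinearMap.mk₀ φ fun a ha => by
    obtain ⟨b, rfl⟩ := CStarAlgebra.nonneg_iff_eq_star_mul_self.1 ha
    exact hφ.nonneg b
  exact map_continuous ψ

variable (α : A ≃⋆ₐ[ℂ] A)

theorem mem_fixedPointAlgebra_zpowersHom {a : A} :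
    a ∈ fixedPointAlgebra (zpowersHom _ α) ↔ α a = a := by
  constructor
  · intro h
    simpa using h (Multiplicative.ofAdd 1)
  · intro h g
    have : ∀ n : ℤ, (α ^ n) a = a := fun n => by
      induction n using Int.induction_on with
      | zero => simp
      | succ n ih => rw [zpow_add_one, StarAlgEquiv.mul_apply, h, ih]
      | pred n ih =>
        rw [zpow_sub_one, StarAlgEquiv.mul_apply]
        have : α⁻¹ a = a := by
          conv_lhs => rw [← h]
          exact α.symm_apply_apply a
        rw [this, ih]
    exact this g.toAdd

theorem isInvariant_zpowersHom {φ : A →ₗ[ℂ] ℂ} :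
    IsInvariant (zpowersHom _ α) φ ↔ ∀ a, φ (α a) = φ a := by
  constructor
  · intro h a
    simpa using h (Multiplicative.ofAdd 1) a
  · intro h g
    have : ∀ (n : ℤ) (a : A), φ ((α ^ n) a) = φ a := fun n => by
      induction n using Int.induction_on with
      | zero => simp
      | succ n ih => intro a; rw [zpow_add_one, StarAlgEquiv.mul_apply, ih, h]
      | pred n ih =>
        intro a
        rw [zpow_sub_one, StarAlgEquiv.mul_apply, ih, ← h]
        exact congrArg φ (α.apply_symm_apply a)
    exact this g.toAdd

theorem cauchySeq_birkhoffAverage_starAlgEquiv_of_isPeriodicPt {a : A} {p : ℕ} (hp : 0 < p)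
    (ha : IsPeriodicPt α p a) : CauchySeq (birkhoffAverage ℂ α _root_.id · a) :=
  cauchySeq_birkhoffAverage_of_isPeriodicPt
    (IsLinearMap.mk' α ⟨fun a b => map_add α a b, fun c a => map_smul α c a⟩)
    (StarAlgEquiv.isometry α).lipschitz hp ha

/-- If the Cesàro averages of every element converge in norm, then the `ℤ`-system generated by a
*-automorphism is uniquely ergodic relative to its fixed point algebra. -/
theorem uniquelyErgodicRelFixed_of_cauchySeq
    (h : ∀ a, CauchySeq (birkhoffAverage ℂ α _root_.id · a)) :
    UniquelyErgodicRelFixed (zpowersHom _ α) := by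
  let _ := CStarAlgebra.spectralOrder A
  have := CStarAlgebra.spectralOrderedRing A
  choose E hE using fun a => cauchySeq_tendsto_of_complete (h a)
  have hcob : ∀ a, Tendsto (fun n => birkhoffAverage ℂ α _root_.id n (α a)
      - birkhoffAverage ℂ α _root_.id n a) atTop (𝓝 0) := fun a =>
    tendsto_birkhoffAverage_apply_sub_birkhoffAverage ℂ
      (isBounded_iff_forall_norm_le.2 ⟨‖a‖, Set.forall_mem_range.2 fun n ↦ by
        have : ∀ n : ℕ, ‖α^[n] a‖ = ‖a‖ := fun n => by
          induction n with
          | zero => rfl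
          | succ n ih => rw [iterate_succ_apply', StarAlgEquiv.norm_map, ih]
        exact (this n).le⟩)
  have hfix : ∀ a, α (E a) = E a := fun a => by
    have h0 := hcob a
    have h1 := (((StarAlgEquiv.isometry α).continuous.tendsto _).comp (hE a)).sub (hE a)
    have h2 : (fun n => birkhoffAverage ℂ α _root_.id n (α a) - birkhoffAverage ℂ α _root_.id n a)
        = fun n => (α ∘ (birkhoffAverage ℂ α _root_.id · a)) n
          - birkhoffAverage ℂ α _root_.id n a := by
      ext n
      simp [birkhoffAverage, birkhoffSum, map_sum, ← iterate_succ_apply' α, iterate_succ_apply]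
    rw [h2] at h0
    exact sub_eq_zero.1 (tendsto_nhds_unique h1 h0)
  have hadd : ∀ a b, E (a + b) = E a + E b := fun a b =>
    tendsto_nhds_unique (hE _) (((hE a).add (hE b)).congr fun n => by
      simp [birkhoffAverage, birkhoffSum, iterate_map_add, Finset.sum_add_distrib])
  have hsmul : ∀ (c : ℂ) a, E (c • a) = c • E a := fun c a =>
    tendsto_nhds_unique (hE _) (((hE a).const_smul c).congr fun n => by
      have : ∀ n : ℕ, α^[n] (c • a) = c • α^[n] a := fun n => by
        induction n with
        | zero => rfl
        | succ n ih => simp only [iterate_succ_apply', ih, map_smul]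
      simp [birkhoffAverage, birkhoffSum, this, Finset.smul_sum, smul_comm c])
  have hself : ∀ a, α a = a → E a = a := fun a ha =>
    tendsto_nhds_unique (hE _) (IsFixedPt.tendsto_birkhoffAverage ℂ ha _root_.id)
  have hpos : ∀ a, 0 ≤ E (star a * a) := fun a => by
    refine CStarAlgebra.isClosed_nonneg.mem_of_tendsto (hE _) (Eventually.of_forall fun n => ?_)
    have hk : ∀ k : ℕ, 0 ≤ α^[k] (star a * a) := fun k => by
      have : α^[k] (star a * a) = star (α^[k] a) * α^[k] a := by
        induction k with
        | zero => rfl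
        | succ k ih => simp only [iterate_succ_apply', ih, map_mul, map_star]
      rw [this]
      exact star_mul_self_nonneg _
    have : birkhoffAverage ℂ α _root_.id n (star a * a)
        = (n : ℝ)⁻¹ • ∑ k ∈ Finset.range n, α^[k] (star a * a) := by
      rw [birkhoffAverage, birkhoffSum, ← Complex.coe_smul]
      simp
    rw [Set.mem_ofPred_eq, this]
    exact smul_nonneg (by positivity) (Finset.sum_nonneg fun k _ => hk k)
  intro φ hφ
  let F : A →ₗ[ℂ] fixedPointAlgebra (zpowersHom _ α) :=
    { toFun a := ⟨E a, (mem_fixedPointAlgebra_zpowersHom α).2 (hfix a)⟩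
      map_add' a b := Subtype.ext (hadd a b)
      map_smul' c a := Subtype.ext (hsmul c a) }
  have hF : ∀ a : fixedPointAlgebra (zpowersHom _ α), F a = a := fun a =>
    Subtype.ext (hself a ((mem_fixedPointAlgebra_zpowersHom α).1 a.2))
  refine ⟨φ ∘ₗ F, ⟨⟨?_, fun a => ?_⟩, ?_, fun a => ?_⟩, ?_⟩
  · exact (congrArg φ (hF 1)).trans hφ.map_one
  -- Positivity of `φ` is known only on `star b * b` with `b` in the fixed point algebra. The square
  -- root of `E (star a * a)` is such a `b`: its image under `α` is another positive root of the
  -- same fixed element.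
  · set b := CFC.sqrt (E (star a * a))
    have hb0 : 0 ≤ b := CFC.sqrt_nonneg _
    have hbb : b * b = E (star a * a) := CFC.sqrt_mul_sqrt_self _ (hpos a)
    have hαb : 0 ≤ α b := by
      obtain ⟨c, hc⟩ := CStarAlgebra.nonneg_iff_eq_star_mul_self.1 hb0
      rw [hc, map_mul, map_star]
      exact star_mul_self_nonneg _
    have hb : α b = b := (CFC.sqrt_unique (by rw [← map_mul, hbb, hfix]) hαb).symm
    have : F (star a * a) = star ⟨b, (mem_fixedPointAlgebra_zpowersHom α).2 hb⟩
        * ⟨b, (mem_fixedPointAlgebra_zpowersHom α).2 hb⟩ :=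
      Subtype.ext (hbb.symm.trans (by
        change b * b = star b * b
        rw [(IsSelfAdjoint.of_nonneg hb0).star_eq]))
    rw [LinearMap.comp_apply, this]
    exact hφ.nonneg _
  · refine (isInvariant_zpowersHom α).2 fun a => congrArg φ (Subtype.ext ?_)
    exact sub_eq_zero.1 (tendsto_nhds_unique ((hE (α a)).sub (hE a)) (hcob a))
  · exact congrArg φ (hF a)
  · rintro ψ ⟨hψ, hinv, hext⟩
    have hinv := (isInvariant_zpowersHom α).1 hinv
    ext a
    -- An invariant `ψ` takes the value `ψ a` on every average except the one at `n = 0`, which is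
    -- zero by convention.
    have h1 : ψ (E a) = ψ a := by
      refine tendsto_nhds_unique ((hψ.continuous.tendsto _).comp (hE a))
        (tendsto_const_nhds.congr' ((eventually_ne_atTop 0).mono fun n hn => ?_))
      have hk : ∀ k : ℕ, ψ (α^[k] a) = ψ a := fun k => by
        induction k with
        | zero => rfl
        | succ k ih => rw [iterate_succ_apply', hinv, ih]
      simp [birkhoffAverage, birkhoffSum, hk, hn]
    rw [← h1]
    exact hext (F a)

end UniqueErgodicity

/-! ### Cancellation in free groups and Haagerup's inequality -/

section Haagerup

/-- Cancellation could only occur at the junction, where the last letter of `invRev s` is the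
inverse of the first letter of `s`. -/
theorem isReduced_invRev_append {α : Type*} [DecidableEq α] {s x : List (α × Bool)}
    (hs : FreeGroup.IsReduced s) (hx : FreeGroup.IsReduced x)
    (h : ∀ a ∈ s.head?, ∀ b ∈ x.head?, a ≠ b) :
    FreeGroup.IsReduced (FreeGroup.invRev s ++ x) := by
  refine List.isChain_append.2 ⟨?_, hx, ?_⟩
  · change FreeGroup.IsReduced (FreeGroup.invRev s)
    rw [FreeGroup.isReduced_iff_reduce_eq, FreeGroup.reduce_invRev, hs.reduce_eq]
  · rcases s with - | ⟨⟨i, c⟩, s⟩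
    · simp [FreeGroup.invRev]
    · rcases x with - | ⟨⟨j, e⟩, x⟩
      · simp
      · have hij := h (i, c) rfl (j, e) rfl
        simp only [FreeGroup.invRev, List.map_cons, List.reverse_cons, List.getLast?_append,
          List.getLast?_singleton, Option.some_or, List.head?_cons, Option.mem_some_iff]
        rintro _ rfl _ rfl rfl
        rcases c <;> rcases e <;> simp_all

/-- Common first letters are stripped one at a time, each cancelling in `s⁻¹ x`; `d` is the length
of the longest common prefix. -/
theorem exists_take_eq_take_and_drop_reduce_eq_drop {α : Type*} [DecidableEq α]
    {s x : List (α × Bool)} (hs : FreeGroup.IsReduced s) (hx : FreeGroup.IsReduced x) :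
    ∃ d ≤ s.length, s.take d = x.take d ∧
      (FreeGroup.reduce (FreeGroup.invRev s ++ x)).drop (s.length - d) = x.drop d := by
  induction s generalizing x with
  | nil => exact ⟨0, le_rfl, by simp, by simp [FreeGroup.invRev, hx.reduce_eq]⟩
  | cons a s ih =>
    by_cases hab : ∃ y, x = a :: y
    · obtain ⟨y, rfl⟩ := hab
      obtain ⟨d, hd, htake, hdrop⟩ := ih (hs.infix (List.suffix_cons a s).isInfix)
        (hx.infix (List.suffix_cons a y).isInfix)
      refine ⟨d + 1, by simpa using hd, by simpa using htake, ?_⟩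
      have hred : FreeGroup.reduce (FreeGroup.invRev (a :: s) ++ a :: y)
          = FreeGroup.reduce (FreeGroup.invRev s ++ y) := by
        refine FreeGroup.reduce.Step.eq ?_
        have := FreeGroup.Red.Step.not (L₁ := FreeGroup.invRev s) (L₂ := y) (x := a.1) (b := !a.2)
        simpa [FreeGroup.invRev] using this
      rw [hred]
      simpa using hdrop
    · refine ⟨0, by simp, by simp, ?_⟩
      have hred : FreeGroup.IsReduced (FreeGroup.invRev (a :: s) ++ x) := by
        refine isReduced_invRev_append hs hx ?_
        intro c hc b hb hcb
        obtain rfl : a = c := by simpa using hc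
        exact hab ⟨x.tail, hcb ▸ (List.cons_head?_tail hb).symm⟩
      rw [hred.reduce_eq, Nat.sub_zero, List.drop_zero]
      exact List.drop_left' FreeGroup.invRev_length

/-- Words `s` and `x` in a free group factor as `s = u v` and `x = u w` without cancellation in
`s⁻¹ x = v⁻¹ w`. -/
theorem exists_take_eq_take_and_drop_eq_drop {α : Type*} [DecidableEq α]
    (s x : FreeGroup α) :
    ∃ d ≤ s.norm, s.toWord.take d = x.toWord.take d ∧
      (s⁻¹ * x).toWord.drop (s.norm - d) = x.toWord.drop d := by
  rw [FreeGroup.toWord_mul, FreeGroup.toWord_inv]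
  exact exists_take_eq_take_and_drop_reduce_eq_drop FreeGroup.isReduced_toWord
    FreeGroup.isReduced_toWord

theorem norm_map_le {α β : Type*} [DecidableEq α] [DecidableEq β] (f : α → β) (g : FreeGroup α) :
    (FreeGroup.map f g).norm ≤ g.norm := by
  conv_lhs => rw [← FreeGroup.mk_toWord (x := g), FreeGroup.map.mk]
  exact FreeGroup.norm_mk_le.trans (by simp [FreeGroup.norm])

theorem norm_freeGroupCongr {α β : Type*} [DecidableEq α] [DecidableEq β] (e : α ≃ β)
    (g : FreeGroup α) : (FreeGroup.freeGroupCongr e g).norm = g.norm := by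
  refine le_antisymm (norm_map_le e g) ?_
  conv_lhs => rw [← (FreeGroup.freeGroupCongr e).symm_apply_apply g]
  exact norm_map_le e.symm _

/-- The Cauchy–Schwarz estimate for the part of a convolution with a fixed cancellation length. -/
theorem sum_sq_sum_le {Γ U W : Type*} [Group Γ] [DecidableEq U] [DecidableEq W]
    (S X : Finset Γ) (a : Γ → ℝ) {M : ℝ}
    (hM : ∀ Z : Finset Γ, ∑ z ∈ Z, a z ^ 2 ≤ M)
    (p : Γ → U) (q r : Γ → W) (hpr : Function.Injective fun x => (p x, r x))
    (P : Γ → Γ → Prop) [∀ s x, Decidable (P s x)]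
    (hP : ∀ s x, P s x → p s = p x ∧ q (s⁻¹ * x) = r x) :
    ∑ x ∈ X, (∑ s ∈ S with P s x, a (s⁻¹ * x)) ^ 2 ≤ S.card * M := by
  classical
  let Z : Finset Γ := S.biUnion fun s => X.image fun x => s⁻¹ * x
  -- Cauchy–Schwarz at fixed `x`: the contributing `s` lie in the fibre of `p` over `p x`, and `s ↦
  -- s⁻¹ * x` maps them injectively into the fibre of `q` over `r x`.
  have h1 : ∀ x ∈ X, (∑ s ∈ S with P s x, a (s⁻¹ * x)) ^ 2 ≤
      (S.filter fun s => p s = p x).card * ∑ z ∈ Z with q z = r x, a z ^ 2 := by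
    intro x hx
    refine sq_sum_le_card_mul_sum_sq.trans ?_
    gcongr with s _ hs
    · exact fun hs => (hP s x hs).1
    · rw [← Finset.sum_image (f := fun z => a z ^ 2) (g := fun s => s⁻¹ * x)
        (s := S.filter fun s => P s x) (fun s _ t _ h => by simpa using h)]
      refine Finset.sum_le_sum_of_subset_of_nonneg ?_ fun _ _ _ => sq_nonneg _
      intro z hz
      obtain ⟨s, hs, rfl⟩ := Finset.mem_image.1 hz
      rw [Finset.mem_filter] at hs ⊢
      exact ⟨Finset.mem_biUnion.2 ⟨s, hs.1, Finset.mem_image_of_mem _ hx⟩, (hP s x hs.2).2⟩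
  calc ∑ x ∈ X, (∑ s ∈ S with P s x, a (s⁻¹ * x)) ^ 2
      ≤ ∑ x ∈ X, (S.filter fun s => p s = p x).card * ∑ z ∈ Z with q z = r x, a z ^ 2 :=
        Finset.sum_le_sum h1
    _ = ∑ y ∈ X.image fun x => (p x, r x),
        ((S.filter fun s => p s = y.1).card : ℝ) * ∑ z ∈ Z with q z = y.2, a z ^ 2 := by
        rw [Finset.sum_image hpr.injOn]
    -- Enlarging the index set to a full product makes the sum factor into a count of `S` and a
    -- square sum of `a`.
    _ ≤ ∑ y ∈ X.image p ×ˢ X.image r,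
        ((S.filter fun s => p s = y.1).card : ℝ) * ∑ z ∈ Z with q z = y.2, a z ^ 2 := by
        refine Finset.sum_le_sum_of_subset_of_nonneg ?_ fun y _ _ =>
          mul_nonneg (Nat.cast_nonneg _) (Finset.sum_nonneg fun _ _ => sq_nonneg _)
        intro y hy
        obtain ⟨x, hx, rfl⟩ := Finset.mem_image.1 hy
        exact Finset.mk_mem_product (Finset.mem_image_of_mem _ hx) (Finset.mem_image_of_mem _ hx)
    _ = (∑ u ∈ X.image p, ((S.filter fun s => p s = u).card : ℝ))
        * ∑ w ∈ X.image r, ∑ z ∈ Z with q z = w, a z ^ 2 := by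
        rw [Finset.sum_product, Finset.sum_mul_sum]
    _ ≤ S.card * M := by
        gcongr
        · rw [← Nat.cast_sum]
          norm_cast
          simp only [Finset.card_filter]
          rw [Finset.sum_comm, Finset.card_eq_sum_ones]
          refine Finset.sum_le_sum fun s _ => ?_
          rw [Finset.sum_ite_eq]
          split_ifs <;> simp
        · exact (Finset.sum_fiberwise_le_sum_of_sum_fiber_nonneg
            fun _ _ => Finset.sum_nonneg fun _ _ => sq_nonneg _).trans (hM Z)

/-- **Haagerup's inequality** for the indicator function of a finite set of words of length `l`. -/
theorem norm_sum_leftRegular_le {α : Type*} [DecidableEq α] (l : ℕ) (S : Finset (FreeGroup α))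
    (hS : ∀ s ∈ S, s.norm = l) :
    ‖∑ s ∈ S, (leftRegular (FreeGroup α) s : L2 (FreeGroup α) →L[ℂ] L2 (FreeGroup α))‖
      ≤ (l + 1) * √S.card := by
  refine ContinuousLinearMap.opNorm_le_bound _ (by positivity) fun f => ?_
  have hp : (0 : ℝ) < (2 : ENNReal).toReal := by norm_num
  refine lp.norm_le_of_forall_sum_le hp (by positivity) fun X => ?_
  have hM : ∀ Z : Finset (FreeGroup α), ∑ z ∈ Z, ‖f z‖ ^ 2 ≤ ‖f‖ ^ 2 := fun Z => by
    simpa using lp.sum_rpow_le_norm_rpow hp f Z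
  choose d hd htake hdrop using exists_take_eq_take_and_drop_eq_drop (α := α)
  -- Split by cancellation length `k = 0, …, l`. Cauchy–Schwarz over these `l + 1` values gives one
  -- factor `l + 1`; summing the bounds `hk` gives the other.
  have hpt : ∀ x, ‖(∑ s ∈ S, (leftRegular (FreeGroup α) s :
      L2 (FreeGroup α) →L[ℂ] L2 (FreeGroup α))) f x‖ ^ 2 ≤
      (l + 1) * ∑ k ∈ Finset.range (l + 1), (∑ s ∈ S with d s x = k, ‖f (s⁻¹ * x)‖) ^ 2 := by
    intro x
    have h1 : ((∑ s ∈ S, (leftRegular (FreeGroup α) s :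
        L2 (FreeGroup α) →L[ℂ] L2 (FreeGroup α))) f) x = ∑ s ∈ S, f (s⁻¹ * x) := by
      rw [_root_.sum_apply, lp.coeFn_sum, Finset.sum_apply]
      rfl
    have h2 : ‖∑ s ∈ S, f (s⁻¹ * x)‖ ≤
        ∑ k ∈ Finset.range (l + 1), ∑ s ∈ S with d s x = k, ‖f (s⁻¹ * x)‖ := by
      rw [Finset.sum_fiberwise_of_maps_to fun s hs => Finset.mem_range.2 (Nat.lt_succ_of_le
        ((hd s x).trans_eq (hS s hs)))]
      exact norm_sum_le _ _
    rw [h1]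
    calc _ ≤ (∑ k ∈ Finset.range (l + 1), ∑ s ∈ S with d s x = k, ‖f (s⁻¹ * x)‖) ^ 2 := by gcongr
      _ ≤ _ := by
        refine sq_sum_le_card_mul_sum_sq.trans_eq ?_
        simp
  have hk : ∀ k ∈ Finset.range (l + 1),
      ∑ x ∈ X, (∑ s ∈ S with d s x = k, ‖f (s⁻¹ * x)‖) ^ 2 ≤ S.card * ‖f‖ ^ 2 := by
    intro k _
    have := sum_sq_sum_le S X (fun z => ‖f z‖) hM (fun x => x.toWord.take k)
      (fun z => z.toWord.drop (l - k)) (fun x => x.toWord.drop k)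
      (fun x y h => by
        rw [Prod.mk.injEq] at h
        rw [← FreeGroup.toWord_inj, ← List.take_append_drop k x.toWord, h.1, h.2,
          List.take_append_drop])
      -- Membership in `S` is part of the predicate because dropping `l - k` letters is the right
      -- truncation only when `s` has length `l`.
      (fun s x => s ∈ S ∧ d s x = k) (by
        rintro s x ⟨hs, rfl⟩
        refine ⟨htake s x, ?_⟩
        rw [← hdrop s x, hS s hs])
    convert this using 4 with x _
    ext s
    simp
  simp only [ENNReal.toReal_ofNat, Real.rpow_ofNat]
  calc _ ≤ ∑ x ∈ X, ((l + 1 : ℝ) * ∑ k ∈ Finset.range (l + 1),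
        (∑ s ∈ S with d s x = k, ‖f (s⁻¹ * x)‖) ^ 2) := Finset.sum_le_sum fun x _ => hpt x
    _ = (l + 1 : ℝ) * ∑ k ∈ Finset.range (l + 1),
        ∑ x ∈ X, (∑ s ∈ S with d s x = k, ‖f (s⁻¹ * x)‖) ^ 2 := by
        rw [← Finset.mul_sum, Finset.sum_comm]
    _ ≤ (l + 1 : ℝ) * ∑ k ∈ Finset.range (l + 1), (S.card * ‖f‖ ^ 2 : ℝ) := by
        gcongr with k hk'
        exact hk k hk'
    _ = ((l + 1) * √S.card * ‖f‖) ^ 2 := by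
        rw [mul_pow, mul_pow, Real.sq_sqrt (Nat.cast_nonneg _)]
        simp
        ring

end Haagerup

/-! ### Cesàro averages in the reduced C*-algebra of the free group -/

section Dual

variable {Γ : Type*} [Group Γ]

/-- The canonical unitary `λ(g)`, as an element of `C*_r(Γ)`. -/
def reducedUnitary (g : Γ) : reducedCStar Γ := ⟨leftRegular Γ g, leftRegular_mem g⟩

/-- The unitaries `λ(g)` are closed under products and adjoints, so their span is already a
*-algebra. -/
theorem adjoin_leftRegular_le_span :
    (StarAlgebra.adjoin ℂ
      (Set.range fun g : Γ => (leftRegular Γ g : L2 Γ →L[ℂ] L2 Γ)) : Set (L2 Γ →L[ℂ] L2 Γ)) ⊆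
    Submodule.span ℂ (Set.range fun g : Γ => (leftRegular Γ g : L2 Γ →L[ℂ] L2 Γ)) := by
  have hstar : star (Set.range fun g : Γ => (leftRegular Γ g : L2 Γ →L[ℂ] L2 Γ)) ⊆
      Set.range fun g : Γ => (leftRegular Γ g : L2 Γ →L[ℂ] L2 Γ) := by
    rintro a ⟨g, hg⟩
    refine ⟨g⁻¹, ?_⟩
    change (leftRegular Γ g : L2 Γ →L[ℂ] L2 Γ) = star a at hg
    change (leftRegular Γ g⁻¹ : L2 Γ →L[ℂ] L2 Γ) = a
    rw [← star_star a, ← hg, map_inv]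
    rfl
  intro a ha
  rw [SetLike.mem_coe, ← StarSubalgebra.mem_toSubalgebra, StarAlgebra.adjoin_toSubalgebra,
    Set.union_eq_left.2 hstar, ← Subalgebra.mem_toSubmodule, Algebra.adjoin_eq_span] at ha
  have hrange : (Submonoid.closure
      (Set.range fun g : Γ => (leftRegular Γ g : L2 Γ →L[ℂ] L2 Γ)) : Set (L2 Γ →L[ℂ] L2 Γ)) ⊆
      Set.range fun g : Γ => (leftRegular Γ g : L2 Γ →L[ℂ] L2 Γ) := by
    let f : Γ →* (L2 Γ →L[ℂ] L2 Γ) := (unitary _).subtype.comp (leftRegular Γ)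
    change Submonoid.closure (Set.range f) ≤ MonoidHom.mrange f
    exact Submonoid.closure_le.2 le_rfl
  exact Submodule.span_mono hrange ha

theorem dense_span_reducedUnitary :
    Dense (Submodule.span ℂ (Set.range (reducedUnitary (Γ := Γ))) : Set (reducedCStar Γ)) := by
  intro a
  rw [Topology.IsInducing.subtypeVal.closure_eq_preimage_closure_image]
  refine closure_mono ?_ a.2
  refine adjoin_leftRegular_le_span.trans ?_
  have : (Submodule.span ℂ (Set.range (reducedUnitary (Γ := Γ)))).map
      (reducedCStar Γ).toSubalgebra.val.toLinearMap
      = Submodule.span ℂ (Set.range fun g : Γ => (leftRegular Γ g : L2 Γ →L[ℂ] L2 Γ)) := by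
    rw [Submodule.map_span, ← Set.range_comp]
    rfl
  rw [← this]
  exact le_rfl

theorem iterate_dualAut_reducedUnitary (T : MulAut Γ) (n : ℕ) (g : Γ) :
    (dualAut T)^[n] (reducedUnitary g) = reducedUnitary (T^[n] g) := by
  induction n with
  | zero => rfl
  | succ n ih =>
    rw [iterate_succ_apply', iterate_succ_apply', ih]
    exact dualAut_leftRegular T _

theorem lipschitzWith_dualAut (T : MulAut Γ) : LipschitzWith 1 (dualAut T) :=
  (StarAlgEquiv.isometry (dualAut T)).lipschitz

theorem cauchySeq_birkhoffAverage_dualAut (T : MulAut Γ)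
    (h : ∀ g : Γ, CauchySeq (birkhoffAverage ℂ (dualAut T) _root_.id · (reducedUnitary g)))
    (a : reducedCStar Γ) : CauchySeq (birkhoffAverage ℂ (dualAut T) _root_.id · a) := by
  refine closure_minimal (s := (Submodule.span ℂ (Set.range (reducedUnitary (Γ := Γ))) :
    Set (reducedCStar Γ))) (fun a ha => ?_)
    (isClosed_setOf_cauchySeq_birkhoffAverage (lipschitzWith_dualAut T))
    (dense_span_reducedUnitary a)
  rw [Set.mem_ofPred_eq]
  induction ha using Submodule.span_induction with
  | mem a ha =>
    obtain ⟨g, rfl⟩ := ha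
    exact h g
  | zero =>
    have : ∀ n : ℕ, birkhoffAverage ℂ (dualAut T) _root_.id n 0 = 0 := fun n => by
      simp [birkhoffAverage, birkhoffSum, iterate_map_zero]
    simpa only [this] using cauchySeq_const (β := ℕ) (0 : reducedCStar Γ)
  | add a b _ _ ha hb =>
    obtain ⟨l, hl⟩ := cauchySeq_tendsto_of_complete ha
    obtain ⟨m, hm⟩ := cauchySeq_tendsto_of_complete hb
    exact ((hl.add hm).congr fun n => by
      simp [birkhoffAverage, birkhoffSum, iterate_map_add, Finset.sum_add_distrib]).cauchySeq
  | smul c a _ ha =>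
    obtain ⟨l, hl⟩ := cauchySeq_tendsto_of_complete ha
    refine ((hl.const_smul c).congr fun n => ?_).cauchySeq
    have hk : ∀ k : ℕ, (dualAut T)^[k] (c • a) = c • (dualAut T)^[k] a := fun k => by
      induction k with
      | zero => rfl
      | succ k ih => simp only [iterate_succ_apply', ih, map_smul]
    simp [birkhoffAverage, birkhoffSum, hk, Finset.smul_sum, smul_comm c]

/-- Injectivity makes the first `n` orbit points distinct, so the Birkhoff sum is a sum over a set
of exactly `n` words of equal length, to which Haagerup's inequality applies. -/
theorem norm_birkhoffSum_reducedUnitary_le {α : Type*} [DecidableEq α] (e : α ≃ α)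
    {g : FreeGroup α} (hg : Injective fun n : ℕ => (FreeGroup.freeGroupCongr e)^[n] g) (n : ℕ) :
    ‖birkhoffSum (dualAut (FreeGroup.freeGroupCongr e : MulAut (FreeGroup α))) _root_.id n
      (reducedUnitary g)‖ ≤ (g.norm + 1) * √n := by
  set T : MulAut (FreeGroup α) := FreeGroup.freeGroupCongr e
  have hnorm : ∀ k : ℕ, (T^[k] g).norm = g.norm := fun k => by
    induction k with
    | zero => rfl
    | succ k ih => rw [iterate_succ_apply', ← ih]; exact norm_freeGroupCongr e _
  have hS := norm_sum_leftRegular_le g.norm ((Finset.range n).image fun k => T^[k] g) (by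
    simp only [Finset.mem_image]
    rintro _ ⟨k, _, rfl⟩
    exact hnorm k)
  rw [Finset.card_image_of_injective _ hg, Finset.card_range,
    Finset.sum_image hg.injOn] at hS
  have hsum : ((birkhoffSum (dualAut T) _root_.id n (reducedUnitary g) :
      reducedCStar (FreeGroup α)) : L2 (FreeGroup α) →L[ℂ] L2 (FreeGroup α)) =
      ∑ k ∈ Finset.range n, (leftRegular (FreeGroup α) (T^[k] g) :
        L2 (FreeGroup α) →L[ℂ] L2 (FreeGroup α)) := by
    simp only [birkhoffSum, _root_.id, iterate_dualAut_reducedUnitary]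
    rw [AddSubmonoidClass.coe_finsetSum]
    rfl
  rw [← hsum] at hS
  exact hS

theorem cauchySeq_birkhoffAverage_reducedUnitary {α : Type*} (e : α ≃ α) (g : FreeGroup α) :
    CauchySeq (birkhoffAverage ℂ (dualAut (FreeGroup.freeGroupCongr e : MulAut (FreeGroup α)))
      _root_.id · (reducedUnitary g)) := by
  classical
  set T : MulAut (FreeGroup α) := FreeGroup.freeGroupCongr e
  by_cases hg : g ∈ periodicPts T
  · obtain ⟨p, hp, hgp⟩ := hg
    exact cauchySeq_birkhoffAverage_starAlgEquiv_of_isPeriodicPt (dualAut T) hp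
      ((iterate_dualAut_reducedUnitary T p g).trans (congrArg reducedUnitary hgp))
  -- As `T` is injective, a repetition in the forward orbit would make `g` itself periodic.
  · have hinj : Injective fun n : ℕ => T^[n] g := by
      intro m n hmn
      by_contra hne
      rcases Nat.lt_or_gt_of_ne hne with hlt | hlt
      · exact hg (mk_mem_periodicPts (by lia) (iterate_cancel T.injective hmn.symm))
      · exact hg (mk_mem_periodicPts (by lia) (iterate_cancel T.injective hmn))
    refine Tendsto.cauchySeq (x := 0) (squeeze_zero_norm (a := fun n : ℕ => (g.norm + 1) / √n)
      (fun n => ?_) ?_)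
    · have := norm_birkhoffSum_reducedUnitary_le e hinj n
      rw [birkhoffAverage, norm_smul, norm_inv, Complex.norm_natCast]
      rcases n.eq_zero_or_pos with rfl | hn
      · simp
      · have hn' : (0 : ℝ) < n := Nat.cast_pos.2 hn
        calc _ ≤ (n : ℝ)⁻¹ * ((g.norm + 1) * √n) := by gcongr
          _ = (g.norm + 1) / √n := by
            have := Real.sq_sqrt hn'.le
            have := Real.sqrt_pos.2 hn'
            field_simp
            linarith
    · exact tendsto_const_nhds.div_atTop
        (Real.tendsto_sqrt_atTop.comp tendsto_natCast_atTop_atTop)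

end Dual

end DualSystem

end

theorem proposition3p3 {L : Type*} [Countable L] [Infinite L] (e : L ≃ L) :
    DualSystem.UniquelyErgodicRelFixed
      (DualSystem.dualSystem (FreeGroup.freeGroupCongr e : MulAut (FreeGroup L))) :=
  DualSystem.uniquelyErgodicRelFixed_of_cauchySeq _
    (DualSystem.cauchySeq_birkhoffAverage_dualAut _
      (DualSystem.cauchySeq_birkhoffAverage_reducedUnitary e))
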